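/- Let $X\subseteq\mathbb{R}^n$, let $\Xi\subseteq\mathbb{R}^d$ be an arbitrary set, let $\|\cdot\|$ be an arbitrary norm on $\mathbb{R}^d$ with $d(s,s')=\|s-s'\|$, and let $\mathcal F$ be a $\sigma$-algebra on $\Xi$ that contains the Borel sets of $\Xi$. Let $f,r:\mathbb{R}^n\to\mathbb{R}$ and $h:\mathbb{R}^n\times\Xi\to\mathbb{R}$ be such that for every $x\in X$ the function $h(x,\cdot)$ is $\mathcal F$-measurable and $r(x)\ge 0$. Let $N\ge 1$, let $\xi^1,\dots,\xi^N\in\Xi$, and let $P_0=\frac1N\sum_{i=1}^N\delta_{\xi^i}$. For probability measures $P_1,P_2$ on $(\Xi,\mathcal F)$ let $\mathcal W(P_1,P_2)=\inf_K\int_{\Xi\times\Xi}\|s_1-s_2\|\,K(ds_1\times ds_2)\in[0,\infty]$, the infimum being over all probability measures $K$ on $\Xi\times\Xi$ with marginals $P_1$ and $P_2$. For $x\in X$ put $\mathcal P(x)=\{P \text{ a probability measure on }(\Xi,\mathcal F):\ \mathcal W(P,P_0)\le r(x)\}$. If $r(x)=0$ for some $x\in X$, assume for this $x$ that $h(x,\cdot)$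 is upper semicontinuous at each $\xi^i$ and that $h(x,s)\le C(1+\|s\|)$ for all $s\in\Xi$, with some constant $C$; where $r(x)>0$ nothing more is assumed. Consider the decision dependent distributionally robust problem $$(\mathrm{D^3RO})\qquad \inf_{x\in X}\Big\{F(x):=f(x)+\sup_{P\in\mathcal P(x)}\mathbb{E}_P[h(x,\xi)]\Big\}$$ (expectations take values in $[-\infty,\infty]$, as the expectation of the positive part minus that of the negative part, with $\infty-\infty=-\infty$) and the semi-infinite program $$(\mathrm{SIP})\qquad \begin{aligned}\inf_{x,v}\ & f(x)+\tfrac1N\sum_{i=1}^N v_i+r(x)\,v_{N+1}\\ \text{s.t. }& h(x,s)-v_i-v_{N+1}\,d(s,\xi^i)\le 0\quad\forall s\in\Xi,\ \forall i\in\{1,\dots,N\},\\ & x\in X,\ v_1,\dots,v_N\in\mathbb{R},\ v_{N+1}\ge 0.\end{aligned}$$ Then $(\mathrm{D^3RO})$ can be reformulated as $(\mathrm{SIP})$, that is: 1. the two problems have the same optimal value in $[-\infty,\infty]$ (the infimum over an empty set being $+\infty$); 2. for every $x\in X$, $F(x)$ equals the infimum of the objective of $(\mathrm{SIP})$ over all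 $v$ for which $(x,v)$ is feasible; 3. if $(x,v)$ is an optimal solution of $(\mathrm{SIP})$, then $x$ is an optimal solution of $(\mathrm{D^3RO})$ with $F(x)<\infty$; conversely, if $x$ is an optimal solution of $(\mathrm{D^3RO})$ with $F(x)<\infty$ and $r(x)>0$, then there is $v$ such that $(x,v)$ is an optimal solution of $(\mathrm{SIP})$. -/

import Mathlib

open MeasureTheory
open scoped ENNReal

noncomputable section

namespace D3RO

/-- Joint probability distributions on `Ξ × Ξ` with marginals `P₁` and `P₂`. -/
def couplings {Ξ : Type*} [MeasurableSpace Ξ] (P₁ P₂ : Measure Ξ) : Set (Measure (Ξ × Ξ)) :=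
  {K | IsProbabilityMeasure K ∧ K.map Prod.fst = P₁ ∧ K.map Prod.snd = P₂}

/-- The `L₁`-Wasserstein (Kantorovich) distance of two probability measures on a subset `Ξ` of a
normed space: the infimal transport cost over all couplings, with values in `[0, ∞]`. -/
def wasserstein {E : Type*} [NormedAddCommGroup E] {Ξ : Set E} [MeasurableSpace Ξ]
    (P₁ P₂ : Measure Ξ) : ℝ≥0∞ :=
  ⨅ K ∈ couplings P₁ P₂, ∫⁻ z, ENNReal.ofReal ‖(z.1 : E) - (z.2 : E)‖ ∂K

/-- The empirical distribution `(1/N) ∑ δ_{ξⁱ}` of `N` samples. -/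
def empirical {Ξ : Type*} [MeasurableSpace Ξ] {N : ℕ} (ξ : Fin N → Ξ) : Measure Ξ :=
  (N : ℝ≥0∞)⁻¹ • ∑ i, Measure.dirac (ξ i)

/-- The Wasserstein ball of radius `ρ` around the empirical distribution of the samples. -/
def ambiguitySet {E : Type*} [NormedAddCommGroup E] {Ξ : Set E} [MeasurableSpace Ξ]
    {N : ℕ} (ξ : Fin N → Ξ) (ρ : ℝ) : Set (Measure Ξ) :=
  {P | IsProbabilityMeasure P ∧ ((wasserstein P (empirical ξ) : ℝ≥0∞) : EReal) ≤ (ρ : EReal)}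

/-- The expectation `E_P[g]` with values in `[-∞, ∞]`, as the expectation of the positive part
minus that of the negative part (`∞ - ∞` is `-∞` in `EReal`). -/
def expectation {Ξ : Type*} [MeasurableSpace Ξ] (P : Measure Ξ) (g : Ξ → ℝ) : EReal :=
  ((∫⁻ s, ENNReal.ofReal (g s) ∂P : ℝ≥0∞) : EReal) -
    ((∫⁻ s, ENNReal.ofReal (-g s) ∂P : ℝ≥0∞) : EReal)

section Problems

variable {n N : ℕ} {E : Type*} [NormedAddCommGroup E] {Ξ : Set E}

/-- The objective of (D³RO): `f(x) + sup_P E_P[h(x, ·)]`, the supremum being taken over the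
decision dependent Wasserstein ball of radius `r(x)`. -/
def objective [MeasurableSpace Ξ] (f r : EuclideanSpace ℝ (Fin n) → ℝ)
    (h : EuclideanSpace ℝ (Fin n) → Ξ → ℝ) (ξ : Fin N → Ξ) (x : EuclideanSpace ℝ (Fin n)) :
    EReal :=
  (f x : EReal) + ⨆ P ∈ ambiguitySet ξ (r x), expectation P (h x)

/-- The optimal value of (D³RO). -/
def value [MeasurableSpace Ξ] (X : Set (EuclideanSpace ℝ (Fin n)))
    (f r : EuclideanSpace ℝ (Fin n) → ℝ) (h : EuclideanSpace ℝ (Fin n) → Ξ → ℝ)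
    (ξ : Fin N → Ξ) : EReal :=
  ⨅ x ∈ X, objective f r h ξ x

/-- `x` is an optimal solution of (D³RO) (with an optimal value that is not `+∞`). -/
def IsSolution [MeasurableSpace Ξ] (X : Set (EuclideanSpace ℝ (Fin n)))
    (f r : EuclideanSpace ℝ (Fin n) → ℝ) (h : EuclideanSpace ℝ (Fin n) → Ξ → ℝ)
    (ξ : Fin N → Ξ) (x : EuclideanSpace ℝ (Fin n)) : Prop :=
  x ∈ X ∧ objective f r h ξ x < ⊤ ∧ ∀ y ∈ X, objective f r h ξ x ≤ objective f r h ξ y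

/-- The feasible set of the semi-infinite program. The entries `v_1, …, v_N` are
`v i.castSucc` for `i : Fin N`, and `v_{N+1}` is `v (Fin.last N)`. -/
def sipFeasible (X : Set (EuclideanSpace ℝ (Fin n))) (h : EuclideanSpace ℝ (Fin n) → Ξ → ℝ)
    (ξ : Fin N → Ξ) : Set (EuclideanSpace ℝ (Fin n) × (Fin (N + 1) → ℝ)) :=
  {p | p.1 ∈ X ∧ 0 ≤ p.2 (Fin.last N) ∧
    ∀ (s : Ξ) (i : Fin N),
      h p.1 s - p.2 i.castSucc - p.2 (Fin.last N) * ‖(s : E) - (ξ i : E)‖ ≤ 0}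

/-- The objective of the semi-infinite program. -/
def sipObjective (N : ℕ) (f r : EuclideanSpace ℝ (Fin n) → ℝ)
    (p : EuclideanSpace ℝ (Fin n) × (Fin (N + 1) → ℝ)) : ℝ :=
  f p.1 + (1 / (N : ℝ)) * ∑ i : Fin N, p.2 i.castSucc + r p.1 * p.2 (Fin.last N)

/-- The optimal value of the semi-infinite program (`+∞` if it is infeasible). -/
def sipValue (X : Set (EuclideanSpace ℝ (Fin n))) (f r : EuclideanSpace ℝ (Fin n) → ℝ)
    (h : EuclideanSpace ℝ (Fin n) → Ξ → ℝ) (ξ : Fin N → Ξ) : EReal :=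
  ⨅ p ∈ sipFeasible X h ξ, (sipObjective N f r p : EReal)

/-- `p = (x, v)` is an optimal solution of the semi-infinite program. -/
def IsSipSolution (X : Set (EuclideanSpace ℝ (Fin n))) (f r : EuclideanSpace ℝ (Fin n) → ℝ)
    (h : EuclideanSpace ℝ (Fin n) → Ξ → ℝ) (ξ : Fin N → Ξ)
    (p : EuclideanSpace ℝ (Fin n) × (Fin (N + 1) → ℝ)) : Prop :=
  p ∈ sipFeasible X h ξ ∧
    ∀ q ∈ sipFeasible X h ξ, sipObjective N f r p ≤ sipObjective N f r q

end Problems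

end D3RO

end

/-!
For a fixed decision `x`, weak duality follows by extending the multipliers `v₁, …, v_N` to a
function `φ` with `h(x, s) ≤ φ(t) + v_{N+1} ‖s - t‖` and integrating against a coupling.
For strong duality at a positive radius, the pairs (transport cost, expected value of `h(x, ·)`)
attained by the measures on `Ξ × Ξ` with second marginal `P₀` form a convex set in the plane.
Since `P₀` itself has cost `0 < r(x)`, this set has a Lagrange multiplier `v_{N+1}` for the
constraint on the cost. Testing it on the plans that move each `ξⁱ` to a single point `sᵢ`
decouples the samples, and `v_i` is the supremum over `s` of `h(x, s) - v_{N+1} ‖s - ξⁱ‖`.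
At radius zero, `P₀` has to be shown to be asymptotically optimal instead: semicontinuity at the
samples and linear growth provide multipliers `v_i = h(x, ξⁱ) + ε`.
-/

namespace D3RO

section LagrangeMultiplier

/-- The ratios compared here are the slopes of the lines from `(ρ, V)` to `p` and to `q`; the
segment from `q` to `p` meets the line `{ρ} × ℝ` in a point of `S`, hence not above `V`. -/
theorem slope_le_slope_of_convex {S : Set (ℝ × ℝ)} (hS : Convex ℝ S) {ρ V : ℝ}
    (hV : ∀ p ∈ S, p.1 ≤ ρ → p.2 ≤ V) {p q : ℝ × ℝ} (hp : p ∈ S) (hq : q ∈ S)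
    (hρp : ρ < p.1) (hqρ : q.1 < ρ) :
    (p.2 - V) / (p.1 - ρ) ≤ (V - q.2) / (ρ - q.1) := by
  have hqp : 0 < p.1 - q.1 := by linarith
  have hmem := hS hp hq (a := (ρ - q.1) / (p.1 - q.1)) (b := (p.1 - ρ) / (p.1 - q.1))
    (div_nonneg (by linarith) hqp.le) (div_nonneg (by linarith) hqp.le) (by field_simp; ring)
  have hcross := hV _ hmem (le_of_eq (by simp; field_simp; ring))
  simp only [Prod.snd_add, Prod.smul_snd, smul_eq_mul, div_mul_eq_mul_div, ← add_div,
    div_le_iff₀ hqp] at hcross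
  rw [div_le_div_iff₀ (by linarith) (by linarith)]
  linarith

theorem exists_multiplier_of_convex {S : Set (ℝ × ℝ)} (hS : Convex ℝ S) {ρ V : ℝ}
    (hV : ∀ p ∈ S, p.1 ≤ ρ → p.2 ≤ V) (hslater : ∃ q ∈ S, q.1 < ρ) :
    ∃ l, 0 ≤ l ∧ ∀ p ∈ S, p.2 ≤ V + l * (p.1 - ρ) := by
  obtain ⟨q₀, hq₀, hq₀ρ⟩ := hslater
  obtain ⟨l, hlower, hupper⟩ := exists_between_of_forall_le
    (s := insert 0 ((fun p => (p.2 - V) / (p.1 - ρ)) '' {p ∈ S | ρ < p.1}))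
    (t := (fun q => (V - q.2) / (ρ - q.1)) '' {q ∈ S | q.1 < ρ})
    (Set.insert_nonempty _ _) ⟨_, q₀, ⟨hq₀, hq₀ρ⟩, rfl⟩ (by
      rintro _ (rfl | ⟨p, ⟨hp, hρp⟩, rfl⟩) _ ⟨q, ⟨hq, hqρ⟩, rfl⟩
      · exact div_nonneg (sub_nonneg.2 (hV q hq hqρ.le)) (sub_nonneg.2 hqρ.le)
      · exact slope_le_slope_of_convex hS hV hp hq hρp hqρ)
  refine ⟨l, hlower (Set.mem_insert _ _), fun p hp => ?_⟩
  rcases lt_trichotomy p.1 ρ with hpρ | hpρ | hρp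
  · have := hupper ⟨p, ⟨hp, hpρ⟩, rfl⟩
    rw [le_div_iff₀ (by linarith)] at this
    linarith
  · simpa [hpρ] using hV p hp hpρ.le
  · have := hlower (Set.mem_insert_of_mem _ ⟨p, ⟨hp, hρp⟩, rfl⟩)
    rw [div_le_iff₀ (by linarith)] at this
    linarith

end LagrangeMultiplier

section SeparableSum

variable {ι T : Type*} [Fintype ι] [Nonempty T] {G : ι → T → ℝ} {B : ℝ}

theorem bddAbove_range_of_forall_sum_le (hB : ∀ s : ι → T, ∑ i, G i (s i) ≤ B) (i : ι) :
    BddAbove (Set.range (G i)) := by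
  classical
  obtain ⟨t₀⟩ := ‹Nonempty T›
  refine ⟨B - ∑ j ∈ Finset.univ.erase i, G j t₀, ?_⟩
  rintro _ ⟨t, rfl⟩
  have hothers : ∑ j ∈ Finset.univ.erase i, G j (Function.update (fun _ => t₀) i t j) =
      ∑ j ∈ Finset.univ.erase i, G j t₀ :=
    Finset.sum_congr rfl fun j hj => by rw [Function.update_of_ne (Finset.ne_of_mem_erase hj)]
  have hsum := hB (Function.update (fun _ => t₀) i t)
  rw [← Finset.add_sum_erase _ _ (Finset.mem_univ i), Function.update_self, hothers] at hsum
  linarith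

theorem sum_ciSup_le_of_forall_sum_le (hB : ∀ s : ι → T, ∑ i, G i (s i) ≤ B) :
    ∑ i, ⨆ t, G i t ≤ B := by
  rcases isEmpty_or_nonempty ι with hι | hι
  · simpa using hB isEmptyElim
  refine le_of_forall_pos_le_add fun ε hε => ?_
  have hcard : (0 : ℝ) < Fintype.card ι := by exact_mod_cast Fintype.card_pos
  choose s hs using fun i =>
    exists_lt_of_lt_ciSup (sub_lt_self (⨆ t, G i t) (div_pos hε hcard))
  calc ∑ i, ⨆ t, G i t ≤ ∑ i, (G i (s i) + ε / Fintype.card ι) :=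
        Finset.sum_le_sum fun i _ => (sub_lt_iff_lt_add.1 (hs i)).le
    _ = ∑ i, G i (s i) + ε := by
        rw [Finset.sum_add_distrib, Finset.sum_const, Finset.card_univ, nsmul_eq_mul,
          mul_div_cancel₀ _ hcard.ne']
    _ ≤ B + ε := by linarith [hB s]

end SeparableSum

theorem exists_slope_of_upperSemicontinuousAt {α : Type*} [PseudoMetricSpace α] {g : α → ℝ}
    {a : α} (hg : UpperSemicontinuousAt g a) {A B : ℝ} (hgrowth : ∀ s, g s ≤ A + B * dist s a)
    {ε : ℝ} (hε : 0 < ε) :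
    ∃ L, 0 ≤ L ∧ ∀ s, g s ≤ g a + ε + L * dist s a := by
  obtain ⟨δ, hδ, hnear⟩ := Metric.eventually_nhds_iff.1 (hg (g a + ε) (by linarith))
  refine ⟨|B| + |A - g a| / δ, by positivity, fun s => ?_⟩
  rcases lt_or_ge (dist s a) δ with hs | hs
  · have : 0 ≤ (|B| + |A - g a| / δ) * dist s a := by positivity
    linarith [hnear hs]
  · have hA : A - g a ≤ |A - g a| / δ * dist s a := by
      rw [div_mul_eq_mul_div, le_div_iff₀ hδ]
      exact mul_le_mul (le_abs_self _) hs hδ.le (abs_nonneg _)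
    have hB : B * dist s a ≤ |B| * dist s a := by gcongr; exact le_abs_self B
    linarith [hgrowth s]

section Measure

variable {Ω Ω' : Type*} [MeasurableSpace Ω] [MeasurableSpace Ω']

theorem aemeasurable_of_ae_snd_mem_countable [MeasurableSingletonClass Ω'] {β : Type*}
    [MeasurableSpace β] {K : Measure (Ω × Ω')} {F : Ω × Ω' → β} {S : Set Ω'} (hS : S.Countable)
    (hK : ∀ᵐ z ∂K, z.2 ∈ S) (hF : ∀ t ∈ S, Measurable fun s => F (s, t)) : AEMeasurable F K := by
  have := hS.to_subtype
  have hcover : K.restrict (⋃ t : S, {z | z.2 = t}) = K :=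
    Measure.restrict_eq_self_of_ae_mem (hK.mono fun z hz => Set.mem_iUnion.2 ⟨⟨z.2, hz⟩, rfl⟩)
  rw [← hcover, aemeasurable_iUnion_iff]
  intro t
  refine ⟨fun z => F (z.1, t), (hF t t.2).comp measurable_fst, ?_⟩
  filter_upwards [ae_restrict_mem (measurable_snd (measurableSet_singleton (t : Ω')))] with z hz
  rw [← (hz : z.2 = t)]

theorem expectation_eq_integral {P : Measure Ω} {g : Ω → ℝ} (hg : Integrable g P) :
    expectation P g = ((∫ s, g s ∂P : ℝ) : EReal) := by
  rw [expectation, integral_eq_lintegral_pos_part_sub_lintegral_neg_part hg, EReal.coe_sub,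
    EReal.coe_ennreal_toReal hg.lintegral_lt_top.ne, EReal.coe_ennreal_toReal]
  exact hg.neg.lintegral_lt_top.ne

theorem expectation_mono {P : Measure Ω} {g k : Ω → ℝ} (hgk : ∀ s, g s ≤ k s) :
    expectation P g ≤ expectation P k :=
  EReal.sub_le_sub
    (EReal.coe_ennreal_le_coe_ennreal_iff.2 <|
      lintegral_mono fun s => ENNReal.ofReal_le_ofReal (hgk s))
    (EReal.coe_ennreal_le_coe_ennreal_iff.2 <|
      lintegral_mono fun s => ENNReal.ofReal_le_ofReal (neg_le_neg (hgk s)))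

theorem expectation_map {K : Measure Ω} {φ : Ω → Ω'} (hφ : Measurable φ) {g : Ω' → ℝ}
    (hg : Measurable g) : expectation (K.map φ) g = expectation K (fun z => g (φ z)) := by
  rw [expectation, expectation, lintegral_map hg.ennreal_ofReal hφ,
    lintegral_map (f := fun t => ENNReal.ofReal (-g t)) hg.neg.ennreal_ofReal hφ]

end Measure

section Empirical

variable {Ω Ω' : Type*} [MeasurableSpace Ω] [MeasurableSpace Ω'] {N : ℕ}

theorem map_empirical {φ : Ω → Ω'} (hφ : Measurable φ) (s : Fin N → Ω) :
    (empirical s).map φ = empirical (fun i => φ (s i)) := by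
  simp only [empirical, Measure.map_smul, Measure.map_finset_sum hφ.aemeasurable,
    Measure.map_dirac' hφ]

instance isProbabilityMeasure_empirical [NeZero N] (s : Fin N → Ω) :
    IsProbabilityMeasure (empirical s) :=
  ⟨by simp [empirical, ENNReal.inv_mul_cancel (NeZero.ne (N : ℝ≥0∞)) (ENNReal.natCast_ne_top N)]⟩

variable [MeasurableSingletonClass Ω]

theorem ae_empirical_mem_range (s : Fin N → Ω) : ∀ᵐ t ∂empirical s, t ∈ Set.range s := by
  refine Measure.ae_smul_measure (ae_finsetSum_measure_iff.2 fun i _ => ?_) _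
  rw [ae_dirac_eq]
  exact Set.mem_range_self i

theorem integrable_empirical [NeZero N] (s : Fin N → Ω) (g : Ω → ℝ) :
    Integrable g (empirical s) :=
  Integrable.smul_measure
    (integrable_finsetSum_measure.2 fun _ _ => integrable_dirac (by simp))
    (ENNReal.inv_ne_top.2 (NeZero.ne _))

theorem integral_empirical (s : Fin N → Ω) (g : Ω → ℝ) :
    ∫ t, g t ∂(empirical s) = 1 / (N : ℝ) * ∑ i, g (s i) := by
  rw [empirical, integral_smul_measure,
    integral_finsetSum_measure fun _ _ => integrable_dirac (by simp)]
  simp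

end Empirical

section Duality

variable {N : ℕ} {E : Type*} [NormedAddCommGroup E] {Ξ : Set E} {ξ : Fin N → Ξ} {g : Ξ → ℝ}
  {a : Fin N → ℝ} {l ρ : ℝ}

/-- Feasibility of the multipliers `(a, l)` in the dual of the problem of maximizing the expectation
of `g` over a Wasserstein ball around the empirical distribution of the samples `ξ`: this is the
constraint of (SIP) at a fixed decision, with `g = h(x, ·)`, `aᵢ = v_i` and `l = v_{N+1}`. -/
structure IsDualFeasible (ξ : Fin N → Ξ) (g : Ξ → ℝ) (a : Fin N → ℝ) (l : ℝ) : Prop where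
  slope_nonneg : 0 ≤ l
  le_add : ∀ (s : Ξ) (i : Fin N), g s ≤ a i + l * ‖(s : E) - (ξ i : E)‖

/-- The value of the multipliers `(a, l)` in the dual problem for a ball of radius `ρ`: this is the
objective of (SIP) without the term `f(x)`. -/
noncomputable def dualObjective (ρ : ℝ) (a : Fin N → ℝ) (l : ℝ) : ℝ :=
  1 / (N : ℝ) * ∑ i, a i + ρ * l

theorem IsDualFeasible.exists_extension [NeZero N] (hfeas : IsDualFeasible ξ g a l) :
    ∃ φ : Ξ → ℝ, (∀ i, φ (ξ i) ≤ a i) ∧ ∀ s t : Ξ, g s ≤ φ t + l * ‖(s : E) - (t : E)‖ := by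
  refine ⟨fun t => ⨅ i, (a i + l * ‖(t : E) - (ξ i : E)‖), fun i => ?_, fun s t => ?_⟩
  · exact (ciInf_le (Set.finite_range _).bddBelow i).trans (by simp)
  · rw [← sub_le_iff_le_add]
    refine le_ciInf fun i => ?_
    have htri := mul_le_mul_of_nonneg_left
      (norm_sub_le_norm_sub_add_norm_sub (s : E) (t : E) (ξ i : E)) hfeas.slope_nonneg
    linarith [hfeas.le_add s i]

theorem exists_isDualFeasible_of_upperSemicontinuousAt
    (husc : ∀ i, UpperSemicontinuousAt g (ξ i)) {C : ℝ} (hC : ∀ s : Ξ, g s ≤ C * (1 + ‖(s : E)‖))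
    {ε : ℝ} (hε : 0 < ε) : ∃ l, IsDualFeasible ξ g (fun i => g (ξ i) + ε) l := by
  have hgrowth : ∀ (i : Fin N) (s : Ξ),
      g s ≤ |C| * (1 + ‖(ξ i : E)‖) + |C| * dist s (ξ i) := fun i s => by
    calc g s ≤ C * (1 + ‖(s : E)‖) := hC s
      _ ≤ |C| * (1 + (‖(ξ i : E)‖ + ‖(s : E) - (ξ i : E)‖)) := by
          gcongr
          exacts [le_abs_self C, norm_le_norm_add_norm_sub' _ _]
      _ = |C| * (1 + ‖(ξ i : E)‖) + |C| * dist s (ξ i) := by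
          rw [Subtype.dist_eq, dist_eq_norm]; ring
  choose L hL hgL using fun i => exists_slope_of_upperSemicontinuousAt (husc i) (hgrowth i) hε
  refine ⟨∑ i, L i, Finset.sum_nonneg fun i _ => hL i, fun s i => (hgL i s).trans ?_⟩
  rw [Subtype.dist_eq, dist_eq_norm]
  gcongr
  exact Finset.single_le_sum (fun j _ => hL j) (Finset.mem_univ i)

variable [MeasurableSpace Ξ]

/-- The worst-case expectation of `g` over the Wasserstein ball of radius `ρ` around the empirical
distribution of the samples `ξ`; the objective of (D³RO) at `x` is `f(x)` plus this quantity for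
`g = h(x, ·)` and `ρ = r(x)`. -/
noncomputable def worstCase (ξ : Fin N → Ξ) (ρ : ℝ) (g : Ξ → ℝ) : EReal :=
  ⨆ P ∈ ambiguitySet ξ ρ, expectation P g

theorem mem_ambiguitySet_iff (hρ : 0 ≤ ρ) {P : Measure Ξ} :
    P ∈ ambiguitySet ξ ρ ↔
      IsProbabilityMeasure P ∧ wasserstein P (empirical ξ) ≤ ENNReal.ofReal ρ := by
  rw [← EReal.coe_ennreal_le_coe_ennreal_iff, EReal.coe_ennreal_ofReal, max_eq_left hρ]
  rfl

/-- The set of pairs (transport cost, expected value of `g` under the first marginal) attained by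
the measures on `Ξ × Ξ` with second marginal `Q` for which both are finite. -/
def transportPairs (Q : Measure Ξ) (g : Ξ → ℝ) : Set (ℝ × ℝ) :=
  {p | ∃ K : Measure (Ξ × Ξ), K.map Prod.snd = Q ∧
    Integrable (fun z => ‖(z.1 : E) - (z.2 : E)‖) K ∧ Integrable (fun z => g z.1) K ∧
    p = (∫ z, ‖(z.1 : E) - (z.2 : E)‖ ∂K, ∫ z, g z.1 ∂K)}

theorem convex_transportPairs (Q : Measure Ξ) (g : Ξ → ℝ) : Convex ℝ (transportPairs Q g) := by
  rintro _ ⟨K, hKQ, hKd, hKg, rfl⟩ _ ⟨K', hKQ', hKd', hKg', rfl⟩ α β hα hβ hαβ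
  lift α to NNReal using hα
  lift β to NNReal using hβ
  have hαβ' : α + β = 1 := by exact_mod_cast hαβ
  refine ⟨α • K + β • K', ?_, hKd.smul_measure_nnreal.add_measure hKd'.smul_measure_nnreal,
    hKg.smul_measure_nnreal.add_measure hKg'.smul_measure_nnreal, ?_⟩
  · rw [Measure.map_add _ _ measurable_snd, Measure.map_smul, Measure.map_smul, hKQ, hKQ',
      ← add_smul, hαβ', one_smul]
  · rw [integral_add_measure hKd.smul_measure_nnreal hKd'.smul_measure_nnreal,
      integral_add_measure hKg.smul_measure_nnreal hKg'.smul_measure_nnreal]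
    simp only [integral_smul_nnreal_measure]
    rfl

section EmpiricalTransport

variable [NeZero N]

theorem snd_le_worstCase (hg : Measurable g) {p : ℝ × ℝ}
    (hp : p ∈ transportPairs (empirical ξ) g) (hpρ : p.1 ≤ ρ) :
    (p.2 : EReal) ≤ worstCase ξ ρ g := by
  obtain ⟨K, hK, hdist, hgK, rfl⟩ := hp
  have : IsProbabilityMeasure (K.map Prod.snd) := hK ▸ inferInstance
  have := Measure.isProbabilityMeasure_of_map (μ := K) Prod.snd
  have hρ : 0 ≤ ρ := (integral_nonneg fun _ => norm_nonneg _).trans hpρ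
  have hmem : K.map Prod.fst ∈ ambiguitySet ξ ρ := by
    refine (mem_ambiguitySet_iff hρ).2
      ⟨Measure.isProbabilityMeasure_map measurable_fst.aemeasurable,
        (iInf₂_le K ⟨this, rfl, hK⟩).trans ?_⟩
    rw [← ofReal_integral_eq_lintegral_ofReal hdist (.of_forall fun _ => norm_nonneg _)]
    exact ENNReal.ofReal_le_ofReal hpρ
  rw [← expectation_eq_integral hgK, ← expectation_map measurable_fst hg]
  exact le_iSup₂ (f := fun P _ => expectation P g) _ hmem

variable [MeasurableSingletonClass Ξ]

theorem average_mem_transportPairs (s : Fin N → Ξ) :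
    (1 / (N : ℝ) * ∑ i, ‖(s i : E) - (ξ i : E)‖, 1 / (N : ℝ) * ∑ i, g (s i)) ∈
      transportPairs (empirical ξ) g :=
  ⟨empirical fun i => (s i, ξ i), map_empirical measurable_snd _, integrable_empirical _ _,
    integrable_empirical _ _, by rw [integral_empirical, integral_empirical]⟩

theorem average_le_worstCase (hg : Measurable g) (hρ : 0 ≤ ρ) :
    ((1 / (N : ℝ) * ∑ i, g (ξ i) : ℝ) : EReal) ≤ worstCase ξ ρ g :=
  snd_le_worstCase hg (average_mem_transportPairs ξ) (by simpa using hρ)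

theorem exists_isDualFeasible_of_worstCase_le (hg : Measurable g) (hρ : 0 < ρ) {V : ℝ}
    (hV : worstCase ξ ρ g ≤ V) :
    ∃ a l, IsDualFeasible ξ g a l ∧ dualObjective ρ a l ≤ V := by
  have hN : (0 : ℝ) < N := by exact_mod_cast NeZero.pos N
  have : Nonempty Ξ := ⟨ξ 0⟩
  obtain ⟨l, hl, hmultiplier⟩ := exists_multiplier_of_convex
    (convex_transportPairs (empirical ξ) g)
    (fun p hp hpρ => EReal.coe_le_coe_iff.1 ((snd_le_worstCase hg hp hpρ).trans hV))
    ⟨_, average_mem_transportPairs ξ, by simpa using hρ⟩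
  let G : Fin N → Ξ → ℝ := fun i s => g s - l * ‖(s : E) - (ξ i : E)‖
  have hdecoupled : ∀ s : Fin N → Ξ, ∑ i, G i (s i) ≤ N * (V - l * ρ) := fun s => by
    have hs := hmultiplier _ (average_mem_transportPairs s)
    rw [Finset.sum_sub_distrib, ← Finset.mul_sum, ← div_le_iff₀' hN, sub_div]
    simp only [one_div_mul_eq_div] at hs
    linarith [mul_div_assoc l (∑ i, ‖(s i : E) - (ξ i : E)‖) N]
  refine ⟨fun i => ⨆ s, G i s, l, ⟨hl, fun s i => ?_⟩, ?_⟩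
  · exact sub_le_iff_le_add.1 (le_ciSup (bddAbove_range_of_forall_sum_le hdecoupled i) s)
  · have hsum := sum_ciSup_le_of_forall_sum_le hdecoupled
    rw [← div_le_iff₀' hN] at hsum
    rw [dualObjective, one_div_mul_eq_div]
    linarith

end EmpiricalTransport

variable [OpensMeasurableSpace Ξ]

/-- The distance may fail to be measurable for the product `σ`-algebra of `Ξ × Ξ`, but the second
coordinate almost surely takes finitely many values. -/
theorem aemeasurable_norm_sub {K : Measure (Ξ × Ξ)} (hK : K.map Prod.snd = empirical ξ) :
    AEMeasurable (fun z => ‖(z.1 : E) - (z.2 : E)‖) K := by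
  have hsamples : ∀ᵐ z ∂K, z.2 ∈ Set.range ξ :=
    ae_of_ae_map measurable_snd.aemeasurable (hK ▸ ae_empirical_mem_range ξ)
  exact aemeasurable_of_ae_snd_mem_countable (Set.countable_range ξ) hsamples fun t _ =>
    (show Continuous fun s : Ξ => ‖(s : E) - (t : E)‖ by fun_prop).measurable

variable [NeZero N]

theorem expectation_le_dualObjective_of_mem_couplings (hg : Measurable g)
    (hfeas : IsDualFeasible ξ g a l) {P : Measure Ξ} {K : Measure (Ξ × Ξ)}
    (hK : K ∈ couplings P (empirical ξ)) (hρ : 0 ≤ ρ)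
    (hcost : ∫⁻ z, ENNReal.ofReal ‖(z.1 : E) - (z.2 : E)‖ ∂K ≤ ENNReal.ofReal ρ) :
    expectation P g ≤ (dualObjective ρ a l : EReal) := by
  obtain ⟨-, hfst, hsnd⟩ := hK
  obtain ⟨φ, hφa, hgφ⟩ := hfeas.exists_extension
  have hdist : Integrable (fun z : Ξ × Ξ => ‖(z.1 : E) - (z.2 : E)‖) K := by
    refine ⟨(aemeasurable_norm_sub hsnd).aestronglyMeasurable, ?_⟩
    rw [hasFiniteIntegral_iff_ofReal (.of_forall fun _ => norm_nonneg _)]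
    exact hcost.trans_lt ENNReal.ofReal_lt_top
  have hdist_le : ∫ z, ‖(z.1 : E) - (z.2 : E)‖ ∂K ≤ ρ := by
    rwa [← ENNReal.ofReal_le_ofReal_iff hρ,
      ofReal_integral_eq_lintegral_ofReal hdist (.of_forall fun _ => norm_nonneg _)]
  have hφ : Integrable φ (K.map Prod.snd) := hsnd ▸ integrable_empirical ξ φ
  have hφK : Integrable (fun z => φ z.2) K := hφ.comp_measurable measurable_snd
  have hφK_eq : ∫ z, φ z.2 ∂K = 1 / (N : ℝ) * ∑ i, φ (ξ i) := by
    rw [← integral_map measurable_snd.aemeasurable hφ.aestronglyMeasurable, hsnd,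
      integral_empirical]
  calc expectation P g = expectation K fun z => g z.1 := by
        rw [← hfst, expectation_map measurable_fst hg]
    _ ≤ expectation K fun z => φ z.2 + l * ‖(z.1 : E) - (z.2 : E)‖ :=
        expectation_mono fun z => hgφ z.1 z.2
    _ = ((1 / (N : ℝ) * ∑ i, φ (ξ i) + l * ∫ z, ‖(z.1 : E) - (z.2 : E)‖ ∂K : ℝ) : EReal) := by
        rw [expectation_eq_integral (g := fun z : Ξ × Ξ => φ z.2 + l * ‖(z.1 : E) - (z.2 : E)‖)
            (hφK.add (hdist.const_mul l)), integral_add hφK (hdist.const_mul l),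
          integral_const_mul, hφK_eq]
    _ ≤ (dualObjective ρ a l : EReal) := by
        rw [EReal.coe_le_coe_iff, dualObjective, mul_comm ρ]
        gcongr with i
        exacts [hφa i, hfeas.slope_nonneg]

theorem worstCase_le_dualObjective (hg : Measurable g) (hρ : 0 ≤ ρ)
    (hfeas : IsDualFeasible ξ g a l) : worstCase ξ ρ g ≤ (dualObjective ρ a l : EReal) := by
  refine iSup₂_le fun P hP => ?_
  -- The infimum in `wasserstein` need not be attained, so the radius is enlarged slightly.
  have hlarger : ∀ c > ρ, expectation P g ≤ (dualObjective c a l : EReal) := fun c hc => by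
    have hlt : wasserstein P (empirical ξ) < ENNReal.ofReal c :=
      ((mem_ambiguitySet_iff hρ).1 hP).2.trans_lt
        ((ENNReal.ofReal_lt_ofReal_iff (hρ.trans_lt hc)).2 hc)
    simp only [wasserstein, iInf_lt_iff] at hlt
    obtain ⟨K, hK, hcost⟩ := hlt
    exact expectation_le_dualObjective_of_mem_couplings hg hfeas hK (hρ.trans hc.le) hcost.le
  have hcont : Continuous fun c => (dualObjective c a l : EReal) :=
    continuous_coe_real_ereal.comp (by unfold dualObjective; fun_prop)
  exact ge_of_tendsto (hcont.continuousWithinAt (s := Set.Ioi ρ))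
    (eventually_mem_nhdsWithin.mono hlarger)

theorem worstCase_lt_iff (hg : Measurable g) (hρ : 0 ≤ ρ)
    (hzero : ρ = 0 → (∀ i, UpperSemicontinuousAt g (ξ i)) ∧
      ∃ C : ℝ, ∀ s : Ξ, g s ≤ C * (1 + ‖(s : E)‖)) {V : ℝ} :
    worstCase ξ ρ g < V ↔ ∃ a l, IsDualFeasible ξ g a l ∧ dualObjective ρ a l < V := by
  refine ⟨fun hV => ?_, fun ⟨a, l, hfeas, hV⟩ =>
    (worstCase_le_dualObjective hg hρ hfeas).trans_lt (EReal.coe_lt_coe_iff.2 hV)⟩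
  rcases hρ.eq_or_lt with rfl | hpos
  · obtain ⟨husc, C, hC⟩ := hzero rfl
    have havg : 1 / (N : ℝ) * ∑ i, g (ξ i) < V :=
      EReal.coe_lt_coe_iff.1 ((average_le_worstCase hg le_rfl).trans_lt hV)
    obtain ⟨ε, hε, hεV⟩ := exists_between (sub_pos.2 havg)
    obtain ⟨l, hfeas⟩ := exists_isDualFeasible_of_upperSemicontinuousAt husc hC hε
    refine ⟨_, l, hfeas, ?_⟩
    have hsum : 1 / (N : ℝ) * ∑ i, (g (ξ i) + ε) = 1 / (N : ℝ) * ∑ i, g (ξ i) + ε := by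
      simp [Finset.sum_add_distrib, mul_add, NeZero.ne]
    rw [dualObjective, hsum]
    linarith
  · obtain ⟨V', hVV', hV'V⟩ := EReal.lt_iff_exists_real_btwn.1 hV
    obtain ⟨a, l, hfeas, hle⟩ := exists_isDualFeasible_of_worstCase_le hg hpos hVV'.le
    exact ⟨a, l, hfeas, hle.trans_lt (EReal.coe_lt_coe_iff.1 hV'V)⟩

end Duality

section Reformulation

variable {n N : ℕ} {E : Type*} [NormedAddCommGroup E] {Ξ : Set E}
  {X : Set (EuclideanSpace ℝ (Fin n))} {f r : EuclideanSpace ℝ (Fin n) → ℝ}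
  {h : EuclideanSpace ℝ (Fin n) → Ξ → ℝ} {ξ : Fin N → Ξ} {x : EuclideanSpace ℝ (Fin n)}
  {v : Fin (N + 1) → ℝ}

theorem mem_sipFeasible_iff :
    (x, v) ∈ sipFeasible X h ξ ↔
      x ∈ X ∧ IsDualFeasible ξ (h x) (Fin.init v) (v (Fin.last N)) := by
  refine and_congr_right fun _ => ⟨fun hv => ⟨hv.1, fun s i => ?_⟩,
    fun hv => ⟨hv.slope_nonneg, fun s i => ?_⟩⟩
  · linarith [hv.2 s i, show Fin.init v i = v i.castSucc from rfl]
  · linarith [hv.le_add s i, show Fin.init v i = v i.castSucc from rfl]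

theorem sipObjective_eq :
    sipObjective N f r (x, v) = f x + dualObjective (r x) (Fin.init v) (v (Fin.last N)) :=
  add_assoc _ _ _

theorem exists_mem_sipFeasible_of_isDualFeasible (hx : x ∈ X) {a : Fin N → ℝ} {l : ℝ}
    (hfeas : IsDualFeasible ξ (h x) a l) :
    ∃ v, (x, v) ∈ sipFeasible X h ξ ∧
      sipObjective N f r (x, v) = f x + dualObjective (r x) a l := by
  refine ⟨Fin.snoc (α := fun _ => ℝ) a l, mem_sipFeasible_iff.2 ⟨hx, ?_⟩, ?_⟩
  · simpa using hfeas
  · simp [sipObjective_eq]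

variable [MeasurableSpace Ξ]

theorem objective_lt_coe_iff {z : ℝ} :
    objective f r h ξ x < z ↔ worstCase ξ (r x) (h x) < ((z - f x : ℝ) : EReal) := by
  rw [EReal.coe_sub, EReal.lt_sub_iff_add_lt (.inl (EReal.coe_ne_bot _))
    (.inl (EReal.coe_ne_top _)), add_comm]
  rfl

section OptimalValue

variable (hobj : ∀ x ∈ X, objective f r h ξ x =
  ⨅ v ∈ {v : Fin (N + 1) → ℝ | (x, v) ∈ sipFeasible X h ξ}, (sipObjective N f r (x, v) : EReal))
include hobj

theorem objective_le_sipObjective (hv : (x, v) ∈ sipFeasible X h ξ) :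
    objective f r h ξ x ≤ (sipObjective N f r (x, v) : EReal) :=
  (hobj x hv.1).trans_le (iInf₂_le v hv)

theorem value_eq_sipValue : value X f r h ξ = sipValue X f r h ξ := by
  refine le_antisymm
    (le_iInf₂ fun p hp => (iInf₂_le p.1 hp.1).trans (objective_le_sipObjective hobj hp))
    (le_iInf₂ fun x hx => ?_)
  rw [hobj x hx]
  exact le_iInf₂ fun v hv => iInf₂_le (x, v) hv

theorem IsSipSolution.isSolution (hsol : IsSipSolution X f r h ξ (x, v)) :
    IsSolution X f r h ξ x := by
  have hle := objective_le_sipObjective hobj hsol.1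
  refine ⟨hsol.1.1, hle.trans_lt (EReal.coe_lt_top _), fun y hy => hle.trans ?_⟩
  rw [hobj y hy]
  exact le_iInf₂ fun w hw => EReal.coe_le_coe_iff.2 (hsol.2 (y, w) hw)

theorem IsSolution.isSipSolution (hsol : IsSolution X f r h ξ x)
    (hv : (x, v) ∈ sipFeasible X h ξ)
    (hattained : (sipObjective N f r (x, v) : EReal) ≤ objective f r h ξ x) :
    IsSipSolution X f r h ξ (x, v) :=
  ⟨hv, fun q hq => EReal.coe_le_coe_iff.1 <|
    hattained.trans ((hsol.2.2 q.1 hq.1).trans (objective_le_sipObjective hobj hq))⟩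

end OptimalValue

variable [OpensMeasurableSpace Ξ] [NeZero N]

theorem objective_eq_iInf_sipObjective (hx : x ∈ X) (hmeas : Measurable (h x)) (hr : 0 ≤ r x)
    (hzero : r x = 0 → (∀ i, UpperSemicontinuousAt (h x) (ξ i)) ∧
      ∃ C : ℝ, ∀ s : Ξ, h x s ≤ C * (1 + ‖(s : E)‖)) :
    objective f r h ξ x = ⨅ v ∈ {v : Fin (N + 1) → ℝ | (x, v) ∈ sipFeasible X h ξ},
      (sipObjective N f r (x, v) : EReal) := by
  refine le_antisymm (le_iInf₂ fun v hv => ?_) (EReal.le_of_forall_lt_iff_le.1 fun z hz => ?_)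
  · rw [sipObjective_eq, EReal.coe_add]
    exact add_le_add_right
      (worstCase_le_dualObjective hmeas hr (mem_sipFeasible_iff.1 hv).2) _
  · obtain ⟨a, l, hfeas, hlt⟩ :=
      (worstCase_lt_iff hmeas hr hzero).1 (objective_lt_coe_iff.1 hz)
    obtain ⟨v, hv, hvobj⟩ := exists_mem_sipFeasible_of_isDualFeasible (f := f) (r := r) hx hfeas
    exact iInf₂_le_of_le v hv (EReal.coe_le_coe_iff.2 (by linarith))

theorem exists_sipObjective_le_objective (hx : x ∈ X) (hmeas : Measurable (h x)) (hr : 0 < r x)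
    (hfin : objective f r h ξ x < ⊤) :
    ∃ v, (x, v) ∈ sipFeasible X h ξ ∧
      (sipObjective N f r (x, v) : EReal) ≤ objective f r h ξ x := by
  have hbot : worstCase ξ (r x) (h x) ≠ ⊥ :=
    ne_bot_of_le_ne_bot (EReal.coe_ne_bot _) (average_le_worstCase hmeas hr.le)
  have htop : worstCase ξ (r x) (h x) ≠ ⊤ := fun htop =>
    hfin.ne (by rw [objective, ← worstCase, htop, EReal.coe_add_top])
  obtain ⟨a, l, hfeas, hle⟩ :=
    exists_isDualFeasible_of_worstCase_le hmeas hr (EReal.coe_toReal htop hbot).ge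
  obtain ⟨v, hv, hvobj⟩ := exists_mem_sipFeasible_of_isDualFeasible (f := f) (r := r) hx hfeas
  refine ⟨v, hv, ?_⟩
  rw [hvobj, EReal.coe_add]
  exact add_le_add_right
    ((EReal.coe_le_coe_iff.2 hle).trans_eq (EReal.coe_toReal htop hbot)) _

end Reformulation

end D3RO

theorem mainTheorem6_general {n N : ℕ} (hN : 0 < N)
    {E : Type*} [NormedAddCommGroup E] {Ξ : Set E} [MeasurableSpace Ξ] [OpensMeasurableSpace Ξ]
    (X : Set (EuclideanSpace ℝ (Fin n)))
    (f r : EuclideanSpace ℝ (Fin n) → ℝ)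
    (h : EuclideanSpace ℝ (Fin n) → Ξ → ℝ)
    (ξ : Fin N → Ξ)
    (hmeas : ∀ x ∈ X, Measurable (h x))
    (hr : ∀ x ∈ X, 0 ≤ r x)
    (hr0 : ∀ x ∈ X, r x = 0 →
      (∀ i, UpperSemicontinuousAt (h x) (ξ i)) ∧
        ∃ C : ℝ, ∀ s : Ξ, h x s ≤ C * (1 + ‖(s : E)‖)) :
    D3RO.value X f r h ξ = D3RO.sipValue X f r h ξ ∧
    (∀ x ∈ X, D3RO.objective f r h ξ x =
      ⨅ v ∈ {v : Fin (N + 1) → ℝ | (x, v) ∈ D3RO.sipFeasible X h ξ},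
        (D3RO.sipObjective N f r (x, v) : EReal)) ∧
    (∀ x v, D3RO.IsSipSolution X f r h ξ (x, v) → D3RO.IsSolution X f r h ξ x) ∧
    (∀ x, 0 < r x → D3RO.IsSolution X f r h ξ x →
      ∃ v, D3RO.IsSipSolution X f r h ξ (x, v)) := by
  have : NeZero N := ⟨hN.ne'⟩
  have hobj : ∀ x ∈ X, D3RO.objective f r h ξ x =
      ⨅ v ∈ {v : Fin (N + 1) → ℝ | (x, v) ∈ D3RO.sipFeasible X h ξ},
        (D3RO.sipObjective N f r (x, v) : EReal) := fun x hx =>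
    D3RO.objective_eq_iInf_sipObjective hx (hmeas x hx) (hr x hx) (hr0 x hx)
  refine ⟨D3RO.value_eq_sipValue hobj, hobj,
    fun x v hsol => hsol.isSolution hobj, fun x hpos hsol => ?_⟩
  obtain ⟨v, hv, hattained⟩ :=
    D3RO.exists_sipObjective_le_objective hsol.1 (hmeas x hsol.1) hpos hsol.2.1
  exact ⟨v, hsol.isSipSolution hobj hv hattained⟩

theorem mainTheorem6 {n N : ℕ} (hN : 0 < N)
    {E : Type*} [NormedAddCommGroup E] [NormedSpace ℝ E] [FiniteDimensional ℝ E]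
    {Ξ : Set E} [MeasurableSpace Ξ] [OpensMeasurableSpace Ξ]
    (X : Set (EuclideanSpace ℝ (Fin n)))
    (f r : EuclideanSpace ℝ (Fin n) → ℝ)
    (h : EuclideanSpace ℝ (Fin n) → Ξ → ℝ)
    (ξ : Fin N → Ξ)
    (hmeas : ∀ x ∈ X, Measurable (h x))
    (hr : ∀ x ∈ X, 0 ≤ r x)
    (hr0 : ∀ x ∈ X, r x = 0 →
      (∀ i, UpperSemicontinuousAt (h x) (ξ i)) ∧
        ∃ C : ℝ, ∀ s : Ξ, h x s ≤ C * (1 + ‖(s : E)‖)) :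
    D3RO.value X f r h ξ = D3RO.sipValue X f r h ξ ∧
    (∀ x ∈ X, D3RO.objective f r h ξ x =
      ⨅ v ∈ {v : Fin (N + 1) → ℝ | (x, v) ∈ D3RO.sipFeasible X h ξ},
        (D3RO.sipObjective N f r (x, v) : EReal)) ∧
    (∀ x v, D3RO.IsSipSolution X f r h ξ (x, v) → D3RO.IsSolution X f r h ξ x) ∧
    (∀ x, 0 < r x → D3RO.IsSolution X f r h ξ x →
      ∃ v, D3RO.IsSipSolution X f r h ξ (x, v)) :=
  mainTheorem6_general hN X f r h ξ hmeas hr hr0
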